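/- Let $n$ be a positive integer, $\mathbb T^n=\mathbb R^n/\mathbb Z^n$, and let $V:\mathbb R^n\to\mathbb R^n$ be a $C^\infty$, $\mathbb Z^n$-periodic vector field which is divergence free and has mean zero, $\int_{\mathbb T^n}V\,dx=0$. For $p\in\mathbb R^n$ put $$c_p=\inf_{\phi\in C^1(\mathbb T^n)}\ \max_{x\in\mathbb T^n}\ V(x)\cdot\bigl(p+D\phi(x)\bigr),$$ where $C^1(\mathbb T^n)$ is the set of $\mathbb Z^n$-periodic $C^1$ functions $\phi:\mathbb R^n\to\mathbb R$ and $D\phi$ is the gradient. A smooth curve $\xi:\mathbb R\to\mathbb R^n$ is an orbit if $\dot\xi(t)=V(\xi(t))$ for all $t\in\mathbb R$; it is a periodic orbit with period $T>0$ if moreover $\xi(T)-\xi(0)\in\mathbb Z^n$ (constant orbits are included). Let $p\in\mathbb R^n$. Then: (i) For every orbit $\xi$, $$\limsup_{T\to+\infty}\frac{p\cdot\xi(T)}{T}\le c_p .$$ In particular, if $\xi$ is a periodic orbit with period $T$, then $\dfrac{p\cdot(\xi(T)-\xi(0))}{T}\le c_p$. (ii) There exists an orbit $\xi$ such that $$\lim_{T\to+\infty}\frac{p\cdot\xi(T)}{T}=c_p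 .$$ (iii) If $n=2$, there exist a periodic orbit $\xi$ and a period $T>0$ of it such that $$\frac{p\cdot(\xi(T)-\xi(0))}{T}=c_p .$$ -/

import Mathlib

open MeasureTheory Filter Topology
open scoped ContDiff

namespace TorusFlow

/-- Euclidean space `ℝⁿ`. -/
abbrev Space (n : ℕ) : Type := EuclideanSpace ℝ (Fin n)

/-- The vector of `ℝⁿ` with integer coordinates `k`. -/
def intVec {n : ℕ} (k : Fin n → ℤ) : Space n := WithLp.toLp 2 (fun i => (k i : ℝ))

/-- `f` is `ℤⁿ`-periodic, that is, `f` is a function on the torus `𝕋ⁿ = ℝⁿ / ℤⁿ`. -/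
def IsPeriodic {n : ℕ} {β : Type*} (f : Space n → β) : Prop :=
  ∀ (x : Space n) (k : Fin n → ℤ), f (x + intVec k) = f x

/-- `φ ∈ C¹(𝕋ⁿ)`. -/
structure IsTorusC1 {n : ℕ} (φ : Space n → ℝ) : Prop where
  contDiff : ContDiff ℝ 1 φ
  periodic : IsPeriodic φ

/-- The unit cube `[0,1)ⁿ`, a fundamental domain of `𝕋ⁿ`. -/
def unitCube (n : ℕ) : Set (Space n) := {x | ∀ i, x i ∈ Set.Ico (0 : ℝ) 1}

/-- The divergence `∑ᵢ ∂Vᵢ/∂xᵢ`. -/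
noncomputable def divergence {n : ℕ} (V : Space n → Space n) (x : Space n) : ℝ :=
  ∑ i, (fderiv ℝ V x (EuclideanSpace.single i 1)) i

/-- The admissible velocity fields: smooth fields on `𝕋ⁿ`, divergence free, with mean zero. -/
structure IsVelocityField {n : ℕ} (V : Space n → Space n) : Prop where
  smooth : ContDiff ℝ ∞ V
  periodic : IsPeriodic V
  div_free : ∀ x, divergence V x = 0
  mean_zero : ∫ x in unitCube n, V x = 0

/-- The set of the numbers `max_{𝕋ⁿ} {V(x) · (p + Dφ(x))}`, with `φ` ranging over `C¹(𝕋ⁿ)`. -/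
def maxValues {n : ℕ} (V : Space n → Space n) (p : Space n) : Set ℝ :=
  {m | ∃ φ : Space n → ℝ, IsTorusC1 φ ∧
    IsGreatest (Set.range fun x => inner ℝ (V x) (p + gradient φ x)) m}

/-- `c_p = inf_{φ ∈ C¹(𝕋ⁿ)} max_{𝕋ⁿ} {V(x) · (p + Dφ(x))}`. The maximum exists for every `φ`, and
the set of maxima is nonempty and bounded below: see the facts proved below. -/
noncomputable def growthRate {n : ℕ} (V : Space n → Space n) (p : Space n) : ℝ :=
  sInf (maxValues V p)

/-- An orbit of `V`: a smooth curve `ξ : ℝ → ℝⁿ` with `ξ'(t) = V(ξ(t))` for all real `t`. -/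
structure IsOrbit {n : ℕ} (V : Space n → Space n) (ξ : ℝ → Space n) : Prop where
  smooth : ContDiff ℝ ∞ ξ
  hasDerivAt : ∀ t, HasDerivAt ξ (V (ξ t)) t

/-- `ξ` is a periodic orbit (on the torus) and `T > 0` is a period of it: `ξ(T) - ξ(0) ∈ ℤⁿ`. -/
structure IsPeriodicOrbit {n : ℕ} (V : Space n → Space n) (ξ : ℝ → Space n) (T : ℝ) : Prop where
  orbit : IsOrbit V ξ
  period_pos : 0 < T
  integral : ∃ k : Fin n → ℤ, ξ T - ξ 0 = intVec k

/-- A continuous function on the torus attains its maximum. -/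
theorem exists_max_of_periodic {n : ℕ} {f : Space n → ℝ} (hf : Continuous f)
    (hp : IsPeriodic f) : ∃ x, ∀ y, f y ≤ f x := by
  obtain ⟨x, -, hx⟩ := (isCompact_closedBall (0 : Space n) (Real.sqrt n)).exists_isMaxOn
    ⟨0, by simp⟩ hf.continuousOn
  refine ⟨x, fun y => ?_⟩
  rw [← hp y (fun i => -⌊y i⌋)]
  apply hx
  rw [mem_closedBall_zero_iff, EuclideanSpace.norm_eq]
  apply Real.sqrt_le_sqrt
  calc ∑ i, ‖(y + intVec fun i => -⌊y i⌋) i‖ ^ 2 ≤ ∑ i : Fin n, (1 : ℝ) := by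
        apply Finset.sum_le_sum
        intro i _
        have h : (y + intVec fun i => -⌊y i⌋) i = Int.fract (y i) := by
          simp [intVec, Int.fract, sub_eq_add_neg]
        rw [h, Real.norm_eq_abs, sq_abs]
        nlinarith [Int.fract_nonneg (y i), (Int.fract_lt_one (y i)).le]
    _ = n := by simp

/-- Every `φ ∈ C¹(𝕋ⁿ)` has its maximum in the definition of `c_p`. -/
theorem exists_isGreatest {n : ℕ} {V : Space n → Space n} (hV : IsVelocityField V) (p : Space n)
    {φ : Space n → ℝ} (hφ : IsTorusC1 φ) :
    ∃ m, IsGreatest (Set.range fun x => inner ℝ (V x) (p + gradient φ x)) m := by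
  have hc : Continuous fun x => inner ℝ (V x) (p + gradient φ x) := by
    refine hV.smooth.continuous.inner (continuous_const.add ?_)
    exact (InnerProductSpace.toDual ℝ (Space n)).symm.continuous.comp
      (hφ.contDiff.continuous_fderiv (by simp))
  obtain ⟨x, hx⟩ := exists_max_of_periodic hc (fun x k => by
    have h : fderiv ℝ φ (x + intVec k) = fderiv ℝ φ x := by
      rw [← fderiv_comp_add_right]
      congr 1
      funext y
      exact hφ.periodic y k
    simp only [hV.periodic x k, gradient, h])
  exact ⟨_, ⟨x, rfl⟩, by rintro _ ⟨y, rfl⟩; exact hx y⟩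

/-- The infimum in the definition of `c_p` is over a nonempty set. -/
theorem maxValues_nonempty {n : ℕ} {V : Space n → Space n} (hV : IsVelocityField V)
    (p : Space n) : (maxValues V p).Nonempty := by
  have h0 : IsTorusC1 (fun _ : Space n => (0 : ℝ)) := ⟨contDiff_const, fun _ _ => rfl⟩
  obtain ⟨m, hm⟩ := exists_isGreatest hV p h0
  exact ⟨m, _, h0, hm⟩

/-- The infimum in the definition of `c_p` is over a set that is bounded below. -/
theorem maxValues_bddBelow {n : ℕ} {V : Space n → Space n} (hV : IsVelocityField V)
    (p : Space n) : BddBelow (maxValues V p) := by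
  obtain ⟨z, hz⟩ := exists_max_of_periodic (f := fun x => -inner ℝ (V x) p)
    (hV.smooth.continuous.inner continuous_const).neg
    (fun x k => by simp only [hV.periodic x k])
  refine ⟨inner ℝ (V z) p, ?_⟩
  rintro m ⟨φ, hφ, hm⟩
  obtain ⟨x, hx⟩ := exists_max_of_periodic hφ.contDiff.continuous hφ.periodic
  have hd : fderiv ℝ φ x = 0 := IsLocalMax.fderiv_eq_zero (Filter.Eventually.of_forall hx)
  have h1 := hm.2 ⟨x, rfl⟩
  simp only [gradient, hd, map_zero, add_zero] at h1
  have h2 := hz x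
  simp only [neg_le_neg_iff] at h2
  exact h2.trans h1

end TorusFlow

open TorusFlow

/-!
For an orbit `ξ` and a test function `φ`, the function `p · ξ + φ(ξ)` grows at the speed
`V · (p + Dφ)`, while `φ` is bounded. So every maximum in the definition of the growth rate `c`
bounds the asymptotic speed of every orbit in the direction `p`.

For the converse, denote the flow by `Φ` and consider the function
`φ(x) = T⁻¹ ∫₀ᵀ p · (Φₜ x - x) dt` (`averagedDisplacement`). Its derivative along orbits is
`p · (Φ_T x - x) / T - p · V(x)`, so that it would be a test function proving
`c ≤ max p · (Φ_T x - x) / T`, were it of class `C¹`. It is Lipschitz, and mollification makes it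
`C¹` at an arbitrarily small cost (`growthRate_le_of_lipschitzWith`); this avoids differentiating
the flow with respect to the initial point. Hence for every `T` some orbit has average speed at
least `c` on `[0, T]`. Restarting such an orbit at the minimum of `p · ξ(t) - (c - ε) t`
(`exists_forall_mem_Icc_le`) and using the compactness of the torus, one finds a point `x` with
`p · (Φₜ x - x) ≥ c t` for all `t ≥ 0` at once. Its orbit has asymptotic speed `c`.

In dimension two, `V` is the rotated gradient of a stream function `H`, by the Poincaré lemma. As
`V` has mean zero, `H` is periodic (`isPeriodic_of_hasFDerivAt_fluxForm`), and it is constant along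
orbits. Let `ξ` be an orbit with asymptotic speed `c`. If `V(ξ(t)) → 0`, then `c = 0`, and `ξ`
accumulates at a stationary point, which is the required periodic orbit. Otherwise `ξ` accumulates
modulo `ℤ²` at a regular point `y`, which lies on the level of `H` that contains `ξ`. Near `y` this
level is a single arc of orbit (`eq_of_stream_eq`), so `ξ` passes through `y` at two different
times modulo `ℤ²` (`exists_orbit_eq_of_dist_lt`), hence it is periodic.
-/

namespace TorusFlow

/-! ### Periodic functions -/

lemma intVec_add {n : ℕ} (k l : Fin n → ℤ) : intVec (k + l) = intVec k + intVec l := by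
  ext i; simp [intVec]

lemma intVec_neg {n : ℕ} (k : Fin n → ℤ) : intVec (-k) = -intVec k := by
  ext i; simp [intVec]

lemma intVec_zero {n : ℕ} : intVec (0 : Fin n → ℤ) = 0 := by
  ext i; simp [intVec]

/-- Every point has a representative modulo `ℤⁿ` in a fixed compact ball. -/
lemma exists_add_intVec_mem_closedBall {n : ℕ} (y : Space n) :
    ∃ k : Fin n → ℤ, y + intVec k ∈ Metric.closedBall (0 : Space n) (Real.sqrt n) := by
  refine ⟨fun i => -⌊y i⌋, ?_⟩
  rw [mem_closedBall_zero_iff, EuclideanSpace.norm_eq]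
  apply Real.sqrt_le_sqrt
  calc ∑ i, ‖(y + intVec fun i => -⌊y i⌋) i‖ ^ 2 ≤ ∑ i : Fin n, (1 : ℝ) := by
        apply Finset.sum_le_sum
        intro i _
        have h : (y + intVec fun i => -⌊y i⌋) i = Int.fract (y i) := by
          simp [intVec, Int.fract, sub_eq_add_neg]
        rw [h, Real.norm_eq_abs, sq_abs]
        nlinarith [Int.fract_nonneg (y i), (Int.fract_lt_one (y i)).le]
    _ = n := by simp

lemma exists_norm_le_of_periodic {n : ℕ} {E : Type*} [NormedAddCommGroup E] {f : Space n → E}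
    (hf : Continuous f) (hp : IsPeriodic f) : ∃ C : ℝ, 0 ≤ C ∧ ∀ x, ‖f x‖ ≤ C := by
  obtain ⟨x, hx⟩ := exists_max_of_periodic (f := fun x => ‖f x‖) hf.norm
    (fun x k => by simp only [hp x k])
  exact ⟨‖f x‖, norm_nonneg _, hx⟩

lemma IsPeriodic.fderiv {n : ℕ} {E : Type*} [NormedAddCommGroup E] [NormedSpace ℝ E]
    {f : Space n → E} (hp : IsPeriodic f) : IsPeriodic (fderiv ℝ f) := by
  intro x k
  rw [← fderiv_comp_add_right]
  congr 1
  funext y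
  exact hp y k

namespace IsVelocityField

variable {n : ℕ} {V : Space n → Space n}

lemma exists_norm_le (hV : IsVelocityField V) : ∃ C : ℝ, 0 ≤ C ∧ ∀ x, ‖V x‖ ≤ C :=
  exists_norm_le_of_periodic hV.smooth.continuous hV.periodic

lemma exists_lipschitzWith (hV : IsVelocityField V) : ∃ K : NNReal, LipschitzWith K V := by
  obtain ⟨C, hC0, hC⟩ := exists_norm_le_of_periodic (hV.smooth.continuous_fderiv (by simp))
    hV.periodic.fderiv
  exact ⟨⟨C, hC0⟩, lipschitzWith_of_nnnorm_fderiv_le (hV.smooth.differentiable (by simp)) hC⟩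

end IsVelocityField

/-! ### The flow of the vector field -/

/-- Solutions of the equation of motion are automatically smooth. -/
lemma isOrbit_of_hasDerivAt {n : ℕ} {V : Space n → Space n} (hV : ContDiff ℝ ∞ V)
    {ξ : ℝ → Space n} (hξ : ∀ t, HasDerivAt ξ (V (ξ t)) t) : IsOrbit V ξ := by
  refine ⟨?_, hξ⟩
  have hd : deriv ξ = V ∘ ξ := funext fun t => (hξ t).deriv
  rw [contDiff_infty]
  intro m
  induction m with
  | zero =>
    exact contDiff_zero.2 (continuous_iff_continuousAt.2 fun t => (hξ t).continuousAt)
  | succ m ih =>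
    push_cast
    rw [contDiff_succ_iff_deriv]
    refine ⟨fun t => (hξ t).differentiableAt, by simp, ?_⟩
    rw [hd]
    exact (contDiff_infty.1 hV m).comp ih

namespace IsOrbit

variable {n : ℕ} {V : Space n → Space n} {ξ η : ℝ → Space n}

lemma continuous (hξ : IsOrbit V ξ) : Continuous ξ := hξ.smooth.continuous

lemma comp_add (hξ : IsOrbit V ξ) (s : ℝ) : IsOrbit V fun t => ξ (t + s) where
  smooth := hξ.smooth.comp (contDiff_id.add contDiff_const)
  hasDerivAt t := (hξ.hasDerivAt (t + s)).comp_add_const t s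

lemma add_intVec (hξ : IsOrbit V ξ) (hp : IsPeriodic V) (k : Fin n → ℤ) :
    IsOrbit V fun t => ξ t + intVec k where
  smooth := hξ.smooth.add contDiff_const
  hasDerivAt t := by
    rw [hp]
    exact (hξ.hasDerivAt t).add_const _

lemma eq_of_eq_at (hξ : IsOrbit V ξ) (hη : IsOrbit V η) {K : NNReal} (hK : LipschitzWith K V)
    {t₀ : ℝ} (h : ξ t₀ = η t₀) : ξ = η :=
  ODE_solution_unique_univ (v := fun _ => V) (s := fun _ => Set.univ) (K := K)
    (fun _ => hK.lipschitzOnWith) (fun t => ⟨hξ.hasDerivAt t, trivial⟩)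
    (fun t => ⟨hη.hasDerivAt t, trivial⟩) h

lemma dist_le (hξ : IsOrbit V ξ) (hη : IsOrbit V η) {K : NNReal} (hK : LipschitzWith K V)
    {t : ℝ} (ht : 0 ≤ t) : dist (ξ t) (η t) ≤ dist (ξ 0) (η 0) * Real.exp (K * t) := by
  simpa using dist_le_of_trajectories_ODE (v := fun _ => V) (fun _ => hK)
    hξ.continuous.continuousOn (fun s _ => (hξ.hasDerivAt s).hasDerivWithinAt)
    hη.continuous.continuousOn (fun s _ => (hη.hasDerivAt s).hasDerivWithinAt)
    le_rfl t ⟨ht, le_rfl⟩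

lemma norm_sub_le (hξ : IsOrbit V ξ) {M : ℝ} (hM : ∀ x, ‖V x‖ ≤ M) (s t : ℝ) :
    ‖ξ t - ξ s‖ ≤ M * |t - s| := by
  simpa using convex_univ.norm_image_sub_le_of_norm_hasDerivWithin_le
    (fun u _ => (hξ.hasDerivAt u).hasDerivWithinAt) (fun u _ => hM (ξ u))
    (Set.mem_univ s) (Set.mem_univ t)

end IsOrbit

/-- Bounded Lipschitz fields have global solutions: solutions on the intervals `[-N, N]` are
provided by the Picard-Lindelöf theorem and agree on overlaps. -/
lemma exists_isOrbit {n : ℕ} {V : Space n → Space n} (hV : IsVelocityField V) (x : Space n) :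
    ∃ ξ : ℝ → Space n, IsOrbit V ξ ∧ ξ 0 = x := by
  obtain ⟨M, hM0, hM⟩ := hV.exists_norm_le
  obtain ⟨K, hK⟩ := hV.exists_lipschitzWith
  have hex : ∀ N : ℕ, ∃ α : ℝ → Space n, α 0 = x ∧
      ∀ t ∈ Set.Icc (-(N : ℝ)) N, HasDerivWithinAt α (V (α t)) (Set.Icc (-(N : ℝ)) N) t := by
    intro N
    have h0 : (0 : ℝ) ∈ Set.Icc (-(N : ℝ)) N := by constructor <;> simp
    have hPL : IsPicardLindelof (fun _ => V) (⟨0, h0⟩ : Set.Icc (-(N : ℝ)) N) x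
        (⟨M, hM0⟩ * N) 0 ⟨M, hM0⟩ K :=
      .of_time_independent (fun y _ => hM y) hK.lipschitzOnWith (by simp; rfl)
    exact hPL.exists_eq_forall_mem_Icc_hasDerivWithinAt₀
  choose α hα0 hα using hex
  have hder : ∀ N : ℕ, ∀ t ∈ Set.Ioo (-(N : ℝ)) N, HasDerivAt (α N) (V (α N t)) t :=
    fun N t ht => (hα N t ⟨ht.1.le, ht.2.le⟩).hasDerivAt (Icc_mem_nhds ht.1 ht.2)
  have hagree : ∀ N N' : ℕ, 0 < N → N ≤ N' → Set.EqOn (α N) (α N') (Set.Ioo (-(N : ℝ)) N) := by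
    intro N N' h0 hle
    have hc : (N : ℝ) ≤ N' := by exact_mod_cast hle
    have h0' : (0 : ℝ) < N := by exact_mod_cast h0
    exact ODE_solution_unique_of_mem_Ioo (v := fun _ => V) (s := fun _ => Set.univ) (K := K)
      (t₀ := 0) (fun _ _ => hK.lipschitzOnWith) ⟨by linarith, h0'⟩
      (fun t ht => ⟨hder N t ht, trivial⟩)
      (fun t ht => ⟨hder N' t ⟨by linarith [ht.1], by linarith [ht.2]⟩, trivial⟩)
      (by rw [hα0, hα0])
  let ξ : ℝ → Space n := fun t => α (⌊|t|⌋₊ + 1) t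
  have hξ : ∀ N : ℕ, 0 < N → Set.EqOn ξ (α N) (Set.Ioo (-(N : ℝ)) N) := by
    intro N h0 t ht
    have hN : |t| < N := abs_lt.2 ht
    have hle : ⌊|t|⌋₊ + 1 ≤ N := (Nat.floor_lt (abs_nonneg t)).2 hN
    refine hagree _ _ (Nat.succ_pos _) hle ?_
    rw [Set.mem_Ioo, ← abs_lt]
    exact_mod_cast Nat.lt_floor_add_one |t|
  refine ⟨ξ, isOrbit_of_hasDerivAt hV.smooth fun t => ?_, by simp [ξ, hα0]⟩
  have hmem : t ∈ Set.Ioo (-((⌊|t|⌋₊ + 1 : ℕ) : ℝ)) (⌊|t|⌋₊ + 1 : ℕ) := by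
    rw [Set.mem_Ioo, ← abs_lt]
    exact_mod_cast Nat.lt_floor_add_one |t|
  refine (hder _ t hmem).congr_of_eventuallyEq ?_
  filter_upwards [Ioo_mem_nhds hmem.1 hmem.2] with s hs
  exact hξ _ (Nat.succ_pos _) hs

/-- The orbit of `V` which is at `x` at time `0`. -/
noncomputable def flow {n : ℕ} {V : Space n → Space n} (hV : IsVelocityField V) (x : Space n) :
    ℝ → Space n :=
  (exists_isOrbit hV x).choose

section Flow

variable {n : ℕ} {V : Space n → Space n} (hV : IsVelocityField V)

lemma isOrbit_flow (x : Space n) : IsOrbit V (flow hV x) := (exists_isOrbit hV x).choose_spec.1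

@[simp] lemma flow_zero (x : Space n) : flow hV x 0 = x := (exists_isOrbit hV x).choose_spec.2

lemma flow_eq_of_isOrbit {ξ : ℝ → Space n} (hξ : IsOrbit V ξ) : flow hV (ξ 0) = ξ := by
  obtain ⟨K, hK⟩ := hV.exists_lipschitzWith
  exact (isOrbit_flow hV _).eq_of_eq_at hξ hK (flow_zero hV _)

lemma flow_flow (x : Space n) (s t : ℝ) : flow hV (flow hV x s) t = flow hV x (t + s) := by
  have h := flow_eq_of_isOrbit hV ((isOrbit_flow hV x).comp_add s)
  rw [zero_add] at h
  rw [h]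

lemma flow_add_intVec (x : Space n) (k : Fin n → ℤ) (t : ℝ) :
    flow hV (x + intVec k) t = flow hV x t + intVec k := by
  have h := flow_eq_of_isOrbit hV ((isOrbit_flow hV x).add_intVec hV.periodic k)
  rw [flow_zero] at h
  rw [h]

lemma exists_lipschitzWith_flow (T : ℝ) :
    ∃ L : NNReal, ∀ t ∈ Set.Icc 0 T, LipschitzWith L fun x => flow hV x t := by
  obtain ⟨K, hK⟩ := hV.exists_lipschitzWith
  refine ⟨⟨Real.exp (K * T), (Real.exp_pos _).le⟩, fun t ht => LipschitzWith.of_dist_le_mul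
    fun x y => ?_⟩
  have h := (isOrbit_flow hV x).dist_le (isOrbit_flow hV y) hK ht.1
  rw [flow_zero, flow_zero, mul_comm] at h
  refine h.trans (mul_le_mul_of_nonneg_right ?_ dist_nonneg)
  exact Real.exp_le_exp.2 (mul_le_mul_of_nonneg_left ht.2 K.2)

end Flow

/-! ### The growth rate bounds every orbit -/

section UpperBound

variable {n : ℕ} {V : Space n → Space n} {p : Space n}

/-- Along an orbit, `p · ξ + φ(ξ)` grows at speed `V · (p + Dφ)`, and `φ` is bounded. -/
lemma IsOrbit.exists_inner_le {ξ : ℝ → Space n} (hξ : IsOrbit V ξ) {m : ℝ}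
    (hm : m ∈ maxValues V p) : ∃ C : ℝ, ∀ T : ℝ, 0 ≤ T → inner ℝ p (ξ T) ≤ m * T + C := by
  obtain ⟨φ, hφ, hmax⟩ := hm
  obtain ⟨B, hB0, hB⟩ := exists_norm_le_of_periodic hφ.contDiff.continuous hφ.periodic
  refine ⟨inner ℝ p (ξ 0) + 2 * B, fun T hT => ?_⟩
  let u : ℝ → ℝ := fun t => m * t - (inner ℝ p (ξ t) + φ (ξ t))
  have hu : ∀ t, HasDerivAt u
      (m - inner ℝ (V (ξ t)) (p + gradient φ (ξ t))) t := by
    intro t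
    have h1 : HasDerivAt (fun t => inner ℝ p (ξ t)) (inner ℝ p (V (ξ t))) t := by
      simpa using (hasDerivAt_const t p).inner ℝ (hξ.hasDerivAt t)
    have h2 : HasDerivAt (fun t => φ (ξ t)) (fderiv ℝ φ (ξ t) (V (ξ t))) t :=
      ((hφ.contDiff.differentiable (by simp) (ξ t)).hasFDerivAt).comp_hasDerivAt t (hξ.hasDerivAt t)
    have h3 : HasDerivAt (fun t : ℝ => m * t) m t := by
      simpa using (hasDerivAt_id t).const_mul m
    have h4 : inner ℝ (V (ξ t)) (p + gradient φ (ξ t)) =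
        inner ℝ p (V (ξ t)) + fderiv ℝ φ (ξ t) (V (ξ t)) := by
      rw [inner_add_right, real_inner_comm p, real_inner_comm (gradient φ (ξ t)), gradient,
        InnerProductSpace.toDual_symm_apply]
    rw [h4]
    exact h3.sub (h1.add h2)
  have hmono : Monotone u := monotone_of_hasDerivAt_nonneg hu
    fun t => sub_nonneg.2 (hmax.2 ⟨ξ t, rfl⟩)
  have h := hmono hT
  simp only [u] at h
  have h0 := abs_le.1 (hB (ξ 0))
  have h1 := abs_le.1 (hB (ξ T))
  linarith [h0.1, h0.2, h1.1, h1.2]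

lemma IsOrbit.limsup_le_growthRate (hV : IsVelocityField V) {ξ : ℝ → Space n}
    (hξ : IsOrbit V ξ) :
    limsup (fun T : ℝ => ((inner ℝ p (ξ T) / T : ℝ) : EReal)) atTop
      ≤ (growthRate V p : EReal) := by
  refine EReal.le_of_forall_lt_iff_le.1 fun c hc => ?_
  rw [EReal.coe_lt_coe_iff] at hc
  obtain ⟨m, hm, hmc⟩ := exists_lt_of_csInf_lt (maxValues_nonempty hV p) hc
  obtain ⟨C, hC⟩ := hξ.exists_inner_le hm
  have hlim : Tendsto (fun T : ℝ => m + C / T) atTop (𝓝 m) := by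
    simpa using (tendsto_const_nhds (x := m)).add (tendsto_const_nhds.div_atTop tendsto_id)
  refine limsup_le_of_le ?_ ?_
  · exact isCobounded_le_of_bot
  filter_upwards [hlim.eventually_lt_const hmc, eventually_gt_atTop 0] with T hT hT0
  rw [EReal.coe_le_coe_iff]
  refine le_trans ?_ hT.le
  rw [div_le_iff₀ hT0, add_mul, div_mul_cancel₀ _ hT0.ne']
  exact hC T hT0.le

/-- The translate of a periodic orbit by a period is its translate by an integer vector. -/
lemma IsPeriodicOrbit.apply_nat_mul (hV : IsVelocityField V) {ξ : ℝ → Space n} {T : ℝ}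
    (hξ : IsPeriodicOrbit V ξ T) (j : ℕ) : ξ (j * T) = ξ 0 + (j : ℝ) • (ξ T - ξ 0) := by
  obtain ⟨k, hk⟩ := hξ.integral
  obtain ⟨K, hK⟩ := hV.exists_lipschitzWith
  have h : (fun t => ξ (t + T)) = fun t => ξ t + intVec k :=
    (hξ.orbit.comp_add T).eq_of_eq_at (hξ.orbit.add_intVec hV.periodic k) hK (t₀ := 0)
      (by simp [← hk])
  induction j with
  | zero => simp
  | succ j ih =>
    have : ξ (j * T + T) = ξ (j * T) + intVec k := congrFun h (j * T)
    rw [Nat.cast_succ, add_mul, one_mul, this, ih, hk, add_smul, one_smul, add_assoc]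

lemma IsPeriodicOrbit.rotation_le_growthRate (hV : IsVelocityField V) {ξ : ℝ → Space n} {T : ℝ}
    (hξ : IsPeriodicOrbit V ξ T) : inner ℝ p (ξ T - ξ 0) / T ≤ growthRate V p := by
  refine le_csInf (maxValues_nonempty hV p) fun m hm => ?_
  rw [div_le_iff₀ hξ.period_pos]
  obtain ⟨C, hC⟩ := hξ.orbit.exists_inner_le hm
  by_contra! hlt
  obtain ⟨j, hj⟩ := exists_nat_gt ((C - inner ℝ p (ξ 0)) / (inner ℝ p (ξ T - ξ 0) - m * T))
  rw [div_lt_iff₀ (sub_pos.2 hlt)] at hj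
  have h := hC (j * T) (mul_nonneg (Nat.cast_nonneg j) hξ.period_pos.le)
  rw [hξ.apply_nat_mul hV, inner_add_right, real_inner_smul_right] at h
  nlinarith

end UpperBound

/-! ### Lipschitz test functions -/

section Smoothing

variable {n : ℕ} {V : Space n → Space n} {p : Space n}

/-- Near `x`, the increment of `φ` over the straight step `h V(x)` is close to its increment
along the orbit, hence to `h g(x)`, uniformly in the base point. -/
lemma abs_sub_sub_le_of_hasDerivAt (hV : IsVelocityField V) {φ g : Space n → ℝ} {K L L' : NNReal}
    (hK : LipschitzWith K V) (hφ : LipschitzWith L φ) (hg : LipschitzWith L' g)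
    (hd : ∀ ξ, IsOrbit V ξ → ∀ t, HasDerivAt (fun t => φ (ξ t)) (g (ξ t)) t)
    {r h : ℝ} (h0 : 0 ≤ h) (hM : ∀ x, ‖V x‖ * h ≤ r) {x z : Space n} (hz : dist z x ≤ r) :
    |φ (z + h • V x) - φ z - h * g x| ≤ (L * K + L') * (2 * r) * h := by
  have hξ := isOrbit_flow hV z
  set ξ := flow hV z with hξdef
  have hξ0 : ξ 0 = z := flow_zero hV z
  have hr : 0 ≤ r := dist_nonneg.trans hz
  have hclose : ∀ s ∈ Set.Icc 0 h, dist (ξ s) x ≤ 2 * r := by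
    intro s hs
    rcases h0.eq_or_lt with rfl | hpos
    · rw [le_antisymm hs.2 hs.1, hξ0]; linarith
    have h1 : ‖ξ s - ξ 0‖ ≤ r / h * |s - 0| :=
      hξ.norm_sub_le (fun y => (le_div_iff₀ hpos).2 (hM y)) 0 s
    have h2 : r / h * |s - 0| ≤ r / h * h := by
      rw [sub_zero, abs_of_nonneg hs.1]
      exact mul_le_mul_of_nonneg_left hs.2 (by positivity)
    rw [div_mul_cancel₀ _ hpos.ne'] at h2
    have h3 : dist (ξ s) z ≤ r := by
      rw [dist_eq_norm, ← hξ0]; exact h1.trans h2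
    linarith [dist_triangle (ξ s) z x]
  have h0mem : (0 : ℝ) ∈ Set.Icc 0 h := ⟨le_rfl, h0⟩
  have hhmem : h ∈ Set.Icc 0 h := ⟨h0, le_rfl⟩
  have e1 : ‖(ξ h - h • V x) - (ξ 0 - (0 : ℝ) • V x)‖ ≤ K * (2 * r) * ‖h - 0‖ := by
    refine (convex_Icc 0 h).norm_image_sub_le_of_norm_hasDerivWithin_le
      (f := fun s => ξ s - s • V x) (f' := fun s => V (ξ s) - V x)
      (fun s _ => ?_) (fun s hs => ?_) h0mem hhmem
    · have := (hξ.hasDerivAt s).sub ((hasDerivAt_id s).smul_const (V x))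
      rw [one_smul] at this
      exact this.hasDerivWithinAt
    · rw [← dist_eq_norm]
      exact (hK.dist_le_mul _ _).trans (mul_le_mul_of_nonneg_left (hclose s hs) K.2)
  have e2 : ‖(φ (ξ h) - h * g x) - (φ (ξ 0) - 0 * g x)‖ ≤ L' * (2 * r) * ‖h - 0‖ := by
    refine (convex_Icc 0 h).norm_image_sub_le_of_norm_hasDerivWithin_le
      (f := fun s => φ (ξ s) - s * g x) (f' := fun s => g (ξ s) - g x)
      (fun s _ => ?_) (fun s hs => ?_) h0mem hhmem
    · have := (hd ξ hξ s).sub ((hasDerivAt_id s).mul_const (g x))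
      rw [one_mul] at this
      exact this.hasDerivWithinAt
    · rw [← dist_eq_norm]
      exact (hg.dist_le_mul _ _).trans (mul_le_mul_of_nonneg_left (hclose s hs) L'.2)
  have e3 : |φ (z + h • V x) - φ (ξ h)| ≤ L * (K * (2 * r) * h) := by
    rw [← Real.dist_eq]
    refine (hφ.dist_le_mul _ _).trans (mul_le_mul_of_nonneg_left ?_ L.2)
    rw [dist_comm, dist_eq_norm]
    rw [sub_zero, Real.norm_of_nonneg h0, hξ0, zero_smul, sub_zero] at e1
    rwa [add_comm, ← sub_sub]
  rw [sub_zero, Real.norm_of_nonneg h0, hξ0, zero_mul, sub_zero, Real.norm_eq_abs] at e2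
  calc |φ (z + h • V x) - φ z - h * g x|
      = |(φ (z + h • V x) - φ (ξ h)) + (φ (ξ h) - h * g x - φ z)| := by congr 1; ring
    _ ≤ _ := abs_add_le _ _
    _ ≤ L * (K * (2 * r) * h) + L' * (2 * r) * h := add_le_add e3 e2
    _ = _ := by ring

open scoped Convolution in
/-- A Lipschitz function can be used in the definition of the growth rate, provided that it is
differentiable along orbits with a Lipschitz derivative `g`: its mollifications `φ ⋆ ρ` satisfy
`V · D(φ ⋆ ρ) ≤ g + ε`. -/
lemma growthRate_le_of_lipschitzWith (hV : IsVelocityField V) {φ g : Space n → ℝ}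
    {L L' : NNReal} (hper : IsPeriodic φ) (hφ : LipschitzWith L φ) (hg : LipschitzWith L' g)
    (hd : ∀ ξ, IsOrbit V ξ → ∀ t, HasDerivAt (fun t => φ (ξ t)) (g (ξ t)) t)
    {m : ℝ} (hm : ∀ x, inner ℝ (V x) p + g x ≤ m) : growthRate V p ≤ m := by
  obtain ⟨K, hK⟩ := hV.exists_lipschitzWith
  obtain ⟨M, hM0, hM⟩ := hV.exists_norm_le
  refine le_of_forall_pos_le_add fun ε hε => ?_
  -- `r` is the radius of the mollifier, chosen so that the error per unit time is at most `ε`.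
  obtain ⟨r, hr, hrε⟩ : ∃ r : ℝ, 0 < r ∧ (L * K + L') * (2 * r) ≤ ε := by
    refine ⟨ε / (2 * (L * K + L' + 1)), by positivity, ?_⟩
    rw [mul_div_assoc', mul_div_assoc', div_le_iff₀ (by positivity)]
    nlinarith [L.2, K.2, L'.2]
  let ρ : ContDiffBump (0 : Space n) := ⟨r / 2, r, by positivity, by linarith⟩
  let ψ : Space n → ℝ := ρ.normed volume ⋆[ContinuousLinearMap.lsmul ℝ ℝ, volume] φ
  have hψ : ContDiff ℝ 1 ψ := ρ.hasCompactSupport_normed.contDiff_convolution_left _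
    ρ.contDiff_normed hφ.continuous.locallyIntegrable
  have hconv : ∀ f : Space n → ℝ, Continuous f →
      ConvolutionExists (ρ.normed volume) f (ContinuousLinearMap.lsmul ℝ ℝ) volume :=
    fun f hf => ρ.hasCompactSupport_normed.convolutionExists_left _ ρ.continuous_normed
      hf.locallyIntegrable
  have hψ1 : IsTorusC1 ψ := by
    refine ⟨hψ, fun x k => ?_⟩
    simp only [ψ, convolution_def]
    congr 1
    funext y
    rw [add_sub_right_comm, hper]
  have hstep : ∀ x, ∀ h : ℝ, 0 ≤ h → M * h ≤ r →
      dist (ψ (x + h • V x) - ψ x) (h * g x) ≤ ε * h := by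
    intro x h h0 hMh
    have hc1 : Continuous fun z => φ (z + h • V x) :=
      hφ.continuous.comp (continuous_id.add continuous_const)
    have heq : ψ (x + h • V x) - ψ x =
        (ρ.normed volume ⋆[ContinuousLinearMap.lsmul ℝ ℝ, volume]
          fun z => φ (z + h • V x) - φ z) x := by
      simp only [ψ, convolution_def]
      rw [← integral_sub (hconv _ hφ.continuous _) (hconv _ hφ.continuous _)]
      congr 1
      funext y
      rw [← map_sub, add_sub_right_comm]
    rw [heq]
    refine dist_convolution_le (by positivity) ρ.support_normed_eq.subset ρ.nonneg_normed
      ρ.integral_normed (hc1.sub hφ.continuous).aestronglyMeasurable fun z hz => ?_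
    rw [Real.dist_eq]
    refine (abs_sub_sub_le_of_hasDerivAt hV hK hφ hg hd h0
      (fun y => (mul_le_mul_of_nonneg_right (hM y) h0).trans hMh) (Metric.mem_ball.1 hz).le).trans
      ?_
    exact mul_le_mul_of_nonneg_right hrε h0
  have hderiv : ∀ x, fderiv ℝ ψ x (V x) ≤ g x + ε := by
    intro x
    have hline : HasDerivAt (fun h : ℝ => ψ (x + h • V x)) (fderiv ℝ ψ x (V x)) 0 := by
      have h1 : HasDerivAt (fun h : ℝ => x + h • V x) (V x) 0 := by
        simpa using ((hasDerivAt_id (0 : ℝ)).smul_const (V x)).const_add x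
      have h2 : HasFDerivAt ψ (fderiv ℝ ψ x) (x + (0 : ℝ) • V x) := by
        rw [zero_smul, add_zero]
        exact (hψ.differentiable (by simp) x).hasFDerivAt
      exact h2.comp_hasDerivAt 0 h1
    refine le_of_tendsto hline.tendsto_slope_zero_right ?_
    have hsmall : Set.Ioo (0 : ℝ) (r / (M + 1)) ∈ 𝓝[>] (0 : ℝ) :=
      Ioo_mem_nhdsGT (by positivity)
    filter_upwards [hsmall] with h hh
    have hMh : M * h ≤ r := by
      have := (lt_div_iff₀ (by positivity)).1 hh.2
      nlinarith [hh.1]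
    have := (abs_le.1 (Real.dist_eq _ _ ▸ hstep x h hh.1.le hMh)).2
    rw [zero_add, zero_smul, add_zero, smul_eq_mul, inv_mul_le_iff₀ hh.1]
    linarith
  obtain ⟨m', hm'⟩ := exists_isGreatest hV p hψ1
  refine (csInf_le (maxValues_bddBelow hV p) ⟨ψ, hψ1, hm'⟩).trans ?_
  obtain ⟨x, hx⟩ := hm'.1
  rw [← hx]
  simp only
  rw [inner_add_right, real_inner_comm (gradient ψ x), gradient,
    InnerProductSpace.toDual_symm_apply]
  linarith [hm x, hderiv x]

end Smoothing

/-! ### An orbit which attains the growth rate -/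

section Attained

variable {n : ℕ} {V : Space n → Space n} {p : Space n}

/-- The time average of the displacement in direction `p` up to time `T`. -/
noncomputable def averagedDisplacement (hV : IsVelocityField V) (p : Space n) (T : ℝ)
    (x : Space n) : ℝ :=
  T⁻¹ * (∫ t in (0 : ℝ)..T, inner ℝ p (flow hV x t)) - inner ℝ p x

lemma continuous_inner_flow (hV : IsVelocityField V) (p x : Space n) :
    Continuous fun t => inner ℝ p (flow hV x t) :=
  continuous_const.inner (isOrbit_flow hV x).continuous

lemma averagedDisplacement_periodic (hV : IsVelocityField V) {T : ℝ} (hT : T ≠ 0) :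
    IsPeriodic (averagedDisplacement hV p T) := by
  intro x k
  simp only [averagedDisplacement, flow_add_intVec, inner_add_right]
  rw [intervalIntegral.integral_add ((continuous_inner_flow hV p x).intervalIntegrable _ _)
    (by simp), intervalIntegral.integral_const, smul_eq_mul, sub_zero]
  field_simp
  ring

lemma exists_lipschitzWith_averagedDisplacement (hV : IsVelocityField V) {T : ℝ} (hT : 0 < T) :
    ∃ L : NNReal, LipschitzWith L (averagedDisplacement hV p T) := by
  obtain ⟨L, hL⟩ := exists_lipschitzWith_flow hV T
  refine ⟨‖p‖₊ * L + ‖p‖₊, LipschitzWith.of_dist_le_mul fun x y => ?_⟩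
  have h1 : ‖∫ t in (0 : ℝ)..T, (inner ℝ p (flow hV x t) - inner ℝ p (flow hV y t))‖ ≤
      ‖p‖ * (L * dist x y) * |T - 0| := by
    refine intervalIntegral.norm_integral_le_of_norm_le_const fun t ht => ?_
    rw [Set.uIoc_of_le hT.le] at ht
    rw [← inner_sub_right]
    refine (norm_inner_le_norm _ _).trans (mul_le_mul_of_nonneg_left ?_ (norm_nonneg _))
    rw [← dist_eq_norm]
    exact (hL t ⟨ht.1.le, ht.2⟩).dist_le_mul x y
  rw [intervalIntegral.integral_sub ((continuous_inner_flow hV p x).intervalIntegrable _ _)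
    ((continuous_inner_flow hV p y).intervalIntegrable _ _), sub_zero, abs_of_pos hT] at h1
  have h2 : |inner ℝ p x - inner ℝ p y| ≤ ‖p‖ * dist x y := by
    rw [← inner_sub_right, dist_eq_norm]
    exact abs_real_inner_le_norm _ _
  have h3 : |T⁻¹ * ((∫ t in (0 : ℝ)..T, inner ℝ p (flow hV x t)) -
      ∫ t in (0 : ℝ)..T, inner ℝ p (flow hV y t))| ≤ ‖p‖ * (L * dist x y) := by
    rw [abs_mul, abs_of_pos (inv_pos.2 hT), inv_mul_le_iff₀ hT, mul_comm T]
    exact h1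
  rw [Real.dist_eq]
  calc _ = |T⁻¹ * ((∫ t in (0 : ℝ)..T, inner ℝ p (flow hV x t)) -
      ∫ t in (0 : ℝ)..T, inner ℝ p (flow hV y t)) - (inner ℝ p x - inner ℝ p y)| := by
        simp only [averagedDisplacement]; congr 1; ring
    _ ≤ _ := abs_sub _ _
    _ ≤ _ := add_le_add h3 h2
    _ = _ := by push_cast; ring

/-- The derivative of the averaged displacement along the flow is the average speed up to time `T`
minus the instantaneous speed. -/
lemma hasDerivAt_averagedDisplacement (hV : IsVelocityField V) (T : ℝ) {ξ : ℝ → Space n}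
    (hξ : IsOrbit V ξ) (s : ℝ) :
    HasDerivAt (fun s => averagedDisplacement hV p T (ξ s))
      (T⁻¹ * inner ℝ p (flow hV (ξ s) T - ξ s) - inner ℝ p (V (ξ s))) s := by
  have hflow : ∀ s t, flow hV (ξ s) t = ξ (t + s) := fun s t => by
    have h := flow_eq_of_isOrbit hV (hξ.comp_add s)
    rw [zero_add] at h
    rw [h]
  have hc : Continuous fun t => inner ℝ p (ξ t) := continuous_const.inner hξ.continuous
  have heq : (fun s => averagedDisplacement hV p T (ξ s)) = fun s =>
      T⁻¹ * ((∫ t in (0 : ℝ)..(T + s), inner ℝ p (ξ t)) - ∫ t in (0 : ℝ)..s, inner ℝ p (ξ t))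
        - inner ℝ p (ξ s) := by
    funext s
    simp only [averagedDisplacement, hflow]
    rw [intervalIntegral.integral_comp_add_right (fun t => inner ℝ p (ξ t)), zero_add,
      intervalIntegral.integral_interval_sub_left (hc.intervalIntegrable _ _)
        (hc.intervalIntegrable _ _)]
  have hF : ∀ u, HasDerivAt (fun u => ∫ t in (0 : ℝ)..u, inner ℝ p (ξ t)) (inner ℝ p (ξ u)) u :=
    fun u => hc.integral_hasStrictDerivAt 0 u |>.hasDerivAt
  have h1 : HasDerivAt (fun t => inner ℝ p (ξ t)) (inner ℝ p (V (ξ s))) s := by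
    simpa using (hasDerivAt_const s p).inner ℝ (hξ.hasDerivAt s)
  rw [heq, hflow, inner_sub_right]
  exact ((((hF (T + s)).comp_const_add T s).sub (hF s)).const_mul T⁻¹).sub h1

/-- The averaged displacement is an almost optimal test function: with it, the quantity maximized
in the definition of the growth rate becomes the average speed up to time `T`. -/
lemma exists_growthRate_mul_le (hV : IsVelocityField V) (p : Space n) {T : ℝ} (hT : 0 < T) :
    ∃ x, growthRate V p * T ≤ inner ℝ p (flow hV x T - x) := by
  obtain ⟨L₁, hL₁⟩ := exists_lipschitzWith_averagedDisplacement (p := p) hV hT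
  obtain ⟨L₂, hL₂⟩ := exists_lipschitzWith_flow hV T
  obtain ⟨K, hK⟩ := hV.exists_lipschitzWith
  have hflow : LipschitzWith L₂ fun x => flow hV x T := hL₂ T ⟨hT.le, le_rfl⟩
  have hinner : ∀ {L : NNReal} {F : Space n → Space n}, LipschitzWith L F →
      LipschitzWith (‖innerSL ℝ p‖₊ * L) fun x => inner ℝ p (F x) :=
    fun hF => (innerSL ℝ p).lipschitz.comp hF
  have hdisp : LipschitzWith _ fun x => inner ℝ p (flow hV x T - x) :=
    hinner (hflow.sub LipschitzWith.id)
  have hg : LipschitzWith _ fun x => T⁻¹ * inner ℝ p (flow hV x T - x) - inner ℝ p (V x) :=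
    ((lipschitzWith_smul T⁻¹).comp hdisp).sub (hinner hK)
  obtain ⟨x, hx⟩ := exists_max_of_periodic hdisp.continuous (fun x k => by
    rw [flow_add_intVec, add_sub_add_right_eq_sub])
  refine ⟨x, ?_⟩
  have h := growthRate_le_of_lipschitzWith (p := p) hV
    (averagedDisplacement_periodic hV hT.ne') hL₁ hg
    (fun ξ hξ t => hasDerivAt_averagedDisplacement hV T hξ t)
    (m := T⁻¹ * inner ℝ p (flow hV x T - x)) (fun y => by
      rw [real_inner_comm, add_sub_cancel]
      exact mul_le_mul_of_nonneg_left (hx y) (inv_pos.2 hT).le)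
  rwa [inv_mul_eq_div, le_div_iff₀ hT] at h

/-- Start at the minimum over a long interval `[0, T]` of the excess `p · ξ(t) - (c - ε) t`. As the
excess is larger by `ε T` at the end, the minimum is reached long before the time `T`. -/
lemma exists_forall_mem_Icc_le (hV : IsVelocityField V) (p : Space n) {N ε : ℝ} (hN : 0 ≤ N)
    (hε : 0 < ε) :
    ∃ x, ∀ t ∈ Set.Icc 0 N, (growthRate V p - ε) * t ≤ inner ℝ p (flow hV x t - x) := by
  obtain ⟨M, hM0, hM⟩ := hV.exists_norm_le
  set c := growthRate V p
  set C := ‖p‖ * M + |c - ε| + 1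
  have hC : 0 < C := by positivity
  have hT : 0 < C * (N + 1) / ε := by positivity
  set T := C * (N + 1) / ε
  obtain ⟨x, hx⟩ := exists_growthRate_mul_le hV p hT
  have hξ := isOrbit_flow hV x
  obtain ⟨t₀, ht₀, hmin⟩ := isCompact_Icc.exists_isMinOn (Set.nonempty_Icc.2 hT.le)
    ((continuous_inner_flow hV p x).sub (continuous_const.mul continuous_id :
      Continuous fun t : ℝ => (c - ε) * t)).continuousOn
  have hmin' : ∀ t ∈ Set.Icc 0 T, inner ℝ p (flow hV x t₀) - (c - ε) * t₀ ≤
      inner ℝ p (flow hV x t) - (c - ε) * t := fun t ht => hmin ht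
  have hlong : N ≤ T - t₀ := by
    have h0 := hmin' 0 ⟨le_rfl, hT.le⟩
    rw [flow_zero] at h0
    have h1 : inner ℝ p (flow hV x T - flow hV x t₀) ≤ ‖p‖ * (M * (T - t₀)) := by
      refine (real_inner_le_norm _ _).trans (mul_le_mul_of_nonneg_left ?_ (norm_nonneg _))
      have := hξ.norm_sub_le hM t₀ T
      rwa [abs_of_nonneg (sub_nonneg.2 ht₀.2)] at this
    rw [inner_sub_right] at h1 hx
    have h2 : -|c - ε| * (T - t₀) ≤ (c - ε) * (T - t₀) :=
      mul_le_mul_of_nonneg_right (neg_abs_le _) (sub_nonneg.2 ht₀.2)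
    have h3 : ε * T = C * (N + 1) := mul_div_cancel₀ _ hε.ne'
    have h4 : C * (N + 1) ≤ C * (T - t₀) := by
      have h5 : C * (T - t₀) = ‖p‖ * (M * (T - t₀)) + |c - ε| * (T - t₀) + (T - t₀) := by
        simp only [C]; ring
      rw [h5, ← h3]
      nlinarith [ht₀.2]
    linarith [le_of_mul_le_mul_left h4 hC]
  refine ⟨flow hV x t₀, fun t ht => ?_⟩
  rw [flow_flow, inner_sub_right]
  have := hmin' (t + t₀) ⟨add_nonneg ht.1 ht₀.1, by linarith [ht.2]⟩
  linarith

/-- Compactness of the torus turns the previous estimates into one for all positive times. -/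
lemma exists_forall_growthRate_mul_le (hV : IsVelocityField V) (p : Space n) :
    ∃ x, ∀ t, 0 ≤ t → growthRate V p * t ≤ inner ℝ p (flow hV x t - x) := by
  have hex : ∀ N : ℕ, ∃ x ∈ Metric.closedBall (0 : Space n) (Real.sqrt n),
      ∀ t ∈ Set.Icc (0 : ℝ) N,
        (growthRate V p - 1 / ((N : ℝ) + 1)) * t ≤ inner ℝ p (flow hV x t - x) := by
    intro N
    obtain ⟨x, hx⟩ := exists_forall_mem_Icc_le hV p (Nat.cast_nonneg N)
      (Nat.one_div_pos_of_nat (α := ℝ) (n := N))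
    obtain ⟨k, hk⟩ := exists_add_intVec_mem_closedBall x
    refine ⟨x + intVec k, hk, fun t ht => ?_⟩
    rw [flow_add_intVec, add_sub_add_right_eq_sub]
    exact hx t ht
  choose x hxmem hx using hex
  obtain ⟨y, -, σ, hσ, hy⟩ :=
    (isCompact_closedBall (0 : Space n) (Real.sqrt n)).tendsto_subseq hxmem
  refine ⟨y, fun t ht => ?_⟩
  obtain ⟨L, hL⟩ := exists_lipschitzWith_flow hV t
  have hcont : Continuous fun x => inner ℝ p (flow hV x t - x) :=
    continuous_const.inner ((hL t ⟨ht, le_rfl⟩).continuous.sub continuous_id)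
  have hl : Tendsto (fun j => (growthRate V p - 1 / ((σ j : ℝ) + 1)) * t) atTop
      (𝓝 ((growthRate V p - 0) * t)) :=
    ((tendsto_const_nhds.sub
      (tendsto_one_div_add_atTop_nhds_zero_nat.comp hσ.tendsto_atTop)).mul_const t)
  rw [sub_zero] at hl
  refine le_of_tendsto_of_tendsto hl ((hcont.tendsto y).comp hy) ?_
  filter_upwards [(tendsto_natCast_atTop_atTop.comp hσ.tendsto_atTop).eventually_ge_atTop t]
    with j hj
  exact hx (σ j) t ⟨ht, hj⟩

lemma exists_isOrbit_tendsto_growthRate (hV : IsVelocityField V) (p : Space n) :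
    ∃ ξ : ℝ → Space n, IsOrbit V ξ ∧
      Tendsto (fun T : ℝ => inner ℝ p (ξ T) / T) atTop (𝓝 (growthRate V p)) := by
  obtain ⟨x, hx⟩ := exists_forall_growthRate_mul_le hV p
  have hξ := isOrbit_flow hV x
  refine ⟨flow hV x, hξ, tendsto_order.2 ⟨fun a ha => ?_, fun b hb => ?_⟩⟩
  · have hlim : Tendsto (fun T : ℝ => growthRate V p + inner ℝ p x / T) atTop
        (𝓝 (growthRate V p)) := by
      simpa using (tendsto_const_nhds (x := growthRate V p)).add
        (tendsto_const_nhds.div_atTop tendsto_id)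
    filter_upwards [hlim.eventually_const_lt ha, eventually_gt_atTop 0] with T hT hT0
    refine hT.trans_le ?_
    rw [le_div_iff₀ hT0, add_mul, div_mul_cancel₀ _ hT0.ne']
    have := hx T hT0.le
    rw [inner_sub_right] at this
    linarith
  · have h := (hξ.limsup_le_growthRate (p := p) hV).trans_lt (EReal.coe_lt_coe_iff.2 hb)
    filter_upwards [eventually_lt_of_limsup_lt h] with T hT
    exact EReal.coe_lt_coe_iff.1 hT

end Attained

/-! ### The stream function in dimension two -/

section Stream

lemma vec_two (x y : ℝ) : (!₂[x, y] : Space 2) =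
    x • EuclideanSpace.single (0 : Fin 2) (1 : ℝ) +
      y • EuclideanSpace.single (1 : Fin 2) (1 : ℝ) := by
  ext i
  fin_cases i <;> simp

lemma integral_unitCube_two {f : Space 2 → ℝ} (hf : Continuous f) :
    (∫ z in unitCube 2, f z) = (∫ x in (0 : ℝ)..1, ∫ y in (0 : ℝ)..1, f !₂[x, y]) ∧
    (∫ z in unitCube 2, f z) = ∫ y in (0 : ℝ)..1, ∫ x in (0 : ℝ)..1, f !₂[x, y] := by
  let e : ℝ × ℝ ≃ᵐ Space 2 := MeasurableEquiv.finTwoArrow.symm.trans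
    (MeasurableEquiv.toLp 2 (Fin 2 → ℝ))
  have he : MeasurePreserving e :=
    (PiLp.volume_preserving_toLp (Fin 2)).comp (volume_preserving_finTwoArrow ℝ).symm
  have hea : ∀ z : ℝ × ℝ, e z = !₂[z.1, z.2] := fun z => rfl
  have hpre : e ⁻¹' unitCube 2 = Set.Ico 0 1 ×ˢ Set.Ico 0 1 := by
    ext z
    simp [unitCube, hea, Fin.forall_fin_two]
  have hae : (Set.Ico (0 : ℝ) 1 ×ˢ Set.Ico (0 : ℝ) 1 : Set (ℝ × ℝ)) =ᵐ[volume]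
      (Set.Ioc 0 1 ×ˢ Set.Ioc 0 1 : Set (ℝ × ℝ)) :=
    Measure.set_prod_ae_eq Ico_ae_eq_Ioc Ico_ae_eq_Ioc
  have hc : Continuous fun z : ℝ × ℝ => f !₂[z.1, z.2] := by
    simp only [vec_two]
    fun_prop
  have hint : Integrable (fun z : ℝ × ℝ => f !₂[z.1, z.2])
      ((volume.restrict (Set.Ioc (0 : ℝ) 1)).prod (volume.restrict (Set.Ioc (0 : ℝ) 1))) := by
    rw [Measure.prod_restrict]
    exact (hc.continuousOn.integrableOn_compact (isCompact_Icc.prod isCompact_Icc)).mono_set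
      (Set.prod_mono Set.Ioc_subset_Icc_self Set.Ioc_subset_Icc_self)
  have h : (∫ z in unitCube 2, f z) = ∫ z, f !₂[z.1, z.2]
      ∂((volume.restrict (Set.Ioc (0 : ℝ) 1)).prod (volume.restrict (Set.Ioc (0 : ℝ) 1))) := by
    rw [← he.setIntegral_preimage_emb e.measurableEmbedding, hpre, setIntegral_congr_set hae,
      Measure.prod_restrict]
    rfl
  simp only [intervalIntegral.integral_of_le zero_le_one]
  exact ⟨h.trans (integral_prod _ hint), h.trans (integral_prod_symm _ hint)⟩

variable {V : Space 2 → Space 2}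

/-- The closed one-form `V₀ dx₁ - V₁ dx₀`, the flux of `V` across curves. -/
noncomputable def fluxForm (V : Space 2 → Space 2) (x : Space 2) : Space 2 →L[ℝ] ℝ :=
  V x 0 • EuclideanSpace.proj 1 - V x 1 • EuclideanSpace.proj 0

lemma fluxForm_apply (V : Space 2 → Space 2) (x u : Space 2) :
    fluxForm V x u = V x 0 * u 1 - V x 1 * u 0 := by
  simp [fluxForm]

/-- A stream function `H`, with `∂₀H = -V₁` and `∂₁H = V₀`, exists because the flux form is closed
for divergence-free fields. -/
lemma exists_hasFDerivAt_fluxForm (hV : IsVelocityField V) :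
    ∃ H : Space 2 → ℝ, ∀ x, HasFDerivAt H (fluxForm V x) x := by
  have hd : ∀ x, HasFDerivAt V (fderiv ℝ V x) x := fun x =>
    (hV.smooth.differentiable (by simp) x).hasFDerivAt
  have hproj : ∀ (i : Fin 2) (x : Space 2), EuclideanSpace.proj (𝕜 := ℝ) i x = x i :=
    fun _ _ => rfl
  have hcoord : ∀ i x, HasFDerivAt (fun x => V x i) (EuclideanSpace.proj i ∘L fderiv ℝ V x) x :=
    fun i x => (EuclideanSpace.proj (𝕜 := ℝ) i).hasFDerivAt.comp x (hd x)
  have hω := fun x => ((hcoord 0 x).smul_const (EuclideanSpace.proj (𝕜 := ℝ) (1 : Fin 2))).sub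
    ((hcoord 1 x).smul_const (EuclideanSpace.proj (𝕜 := ℝ) (0 : Fin 2)))
  have hω' : ∀ x, HasFDerivAt (fluxForm V) _ x := hω
  have hdiff : DifferentiableOn ℝ (fluxForm V) Set.univ :=
    fun x _ => (hω' x).differentiableAt.differentiableWithinAt
  obtain ⟨H, hH⟩ := convex_univ.exists_forall_hasFDerivAt_of_fderiv_symmetric isOpen_univ hdiff (by
      intro a _ u v
      rw [(hω' a).fderiv]
      have hdiv := hV.div_free a
      simp only [divergence, Fin.sum_univ_two] at hdiv
      have hexp : ∀ u : Space 2, fderiv ℝ V a u =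
          u 0 • fderiv ℝ V a (EuclideanSpace.single 0 1) +
          u 1 • fderiv ℝ V a (EuclideanSpace.single 1 1) := by
        intro u
        rw [← map_smul, ← map_smul, ← map_add]
        congr 1
        ext i
        fin_cases i <;> simp
      simp only [sub_apply, ContinuousLinearMap.smulRight_apply,
        ContinuousLinearMap.comp_apply, smul_apply, smul_eq_mul,
        hproj]
      rw [hexp u, hexp v]
      simp only [PiLp.add_apply, PiLp.smul_apply, smul_eq_mul]
      linear_combination (u 0 * v 1 - u 1 * v 0) * hdiv)
  exact ⟨H, fun x => hH x trivial⟩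

lemma intVec_two (k : Fin 2 → ℤ) :
    intVec k = k 0 • EuclideanSpace.single (0 : Fin 2) (1 : ℝ) +
      k 1 • EuclideanSpace.single (1 : Fin 2) (1 : ℝ) := by
  ext i
  fin_cases i <;> simp [intVec]

lemma single_eq_intVec (i : Fin 2) :
    EuclideanSpace.single i (1 : ℝ) = intVec (Pi.single i 1) := by
  ext j
  by_cases h : j = i
  · subst h; simp [intVec]
  · simp [intVec, h]

/-- The stream function is periodic: its increment over a period is a flux of `V` through a
section of the torus, which is, up to sign, the mean of a
coordinate of `V`. -/
lemma isPeriodic_of_hasFDerivAt_fluxForm (hV : IsVelocityField V) {H : Space 2 → ℝ}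
    (hH : ∀ x, HasFDerivAt H (fluxForm V x) x) : IsPeriodic H := by
  have hconst : ∀ i : Fin 2, ∃ α : ℝ, ∀ x, H (x + EuclideanSpace.single i 1) - H x = α := by
    intro i
    refine ⟨H (0 + EuclideanSpace.single i 1) - H 0, fun x => ?_⟩
    have hz : ∀ x, HasFDerivAt (fun x => H (x + EuclideanSpace.single i 1) - H x)
        (0 : Space 2 →L[ℝ] ℝ) x := by
      intro x
      have h1 := ((hasFDerivAt_comp_add_right (EuclideanSpace.single i 1)).2
        (hH (x + EuclideanSpace.single i 1))).sub (hH x)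
      have h2 : fluxForm V (x + EuclideanSpace.single i 1) = fluxForm V x := by
        rw [single_eq_intVec, fluxForm, hV.periodic, fluxForm]
      rwa [h2, sub_self] at h1
    exact is_const_of_fderiv_eq_zero (fun x => (hz x).differentiableAt) (fun x => (hz x).fderiv) x 0
  have hVc : ∀ i : Fin 2, Continuous fun x => V x i := fun i =>
    (EuclideanSpace.proj (𝕜 := ℝ) i).continuous.comp hV.smooth.continuous
  have hmean : ∀ i : Fin 2, ∫ x in unitCube 2, V x i = 0 := by
    intro i
    have hsub : unitCube 2 ⊆ Metric.closedBall (0 : Space 2) (Real.sqrt 2) := by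
      intro x hx
      rw [mem_closedBall_zero_iff, EuclideanSpace.norm_eq]
      apply Real.sqrt_le_sqrt
      rw [Fin.sum_univ_two, Real.norm_eq_abs, Real.norm_eq_abs, sq_abs, sq_abs]
      have h0 := hx 0
      have h1 := hx 1
      nlinarith [h0.1, h0.2, h1.1, h1.2]
    have hint : IntegrableOn V (unitCube 2) :=
      (hV.smooth.continuous.continuousOn.integrableOn_compact
        (isCompact_closedBall (0 : Space 2) (Real.sqrt 2))).mono_set hsub
    have h := (EuclideanSpace.proj (𝕜 := ℝ) i).integral_comp_comm hint
    rw [hV.mean_zero, map_zero] at h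
    exact h
  have hline0 : ∀ y : ℝ, ∀ x : ℝ, HasDerivAt (fun x : ℝ => H !₂[x, y]) (-V !₂[x, y] 1) x := by
    intro y x
    have h1 : HasDerivAt (fun x : ℝ => (!₂[x, y] : Space 2)) (EuclideanSpace.single 0 1) x := by
      simp only [vec_two]
      simpa using
        ((hasDerivAt_id x).smul_const (EuclideanSpace.single (0 : Fin 2) (1 : ℝ))).add_const
          (y • EuclideanSpace.single (1 : Fin 2) (1 : ℝ))
    have h2 : HasDerivAt (fun x : ℝ => H !₂[x, y]) (fluxForm V !₂[x, y] _) x :=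
      (hH !₂[x, y]).comp_hasDerivAt x h1
    simpa [fluxForm_apply] using h2
  have hline1 : ∀ x : ℝ, ∀ y : ℝ, HasDerivAt (fun y : ℝ => H !₂[x, y]) (V !₂[x, y] 0) y := by
    intro x y
    have h1 : HasDerivAt (fun y : ℝ => (!₂[x, y] : Space 2)) (EuclideanSpace.single 1 1) y := by
      simp only [vec_two]
      simpa using
        ((hasDerivAt_id y).smul_const (EuclideanSpace.single (1 : Fin 2) (1 : ℝ))).const_add
          (x • EuclideanSpace.single (0 : Fin 2) (1 : ℝ))
    have h2 : HasDerivAt (fun y : ℝ => H !₂[x, y]) (fluxForm V !₂[x, y] _) y :=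
      (hH !₂[x, y]).comp_hasDerivAt y h1
    simpa [fluxForm_apply] using h2
  have hcx : ∀ y, Continuous fun x : ℝ => (!₂[x, y] : Space 2) := fun y => by
    simp only [vec_two]
    fun_prop
  have hcy : ∀ x, Continuous fun y : ℝ => (!₂[x, y] : Space 2) := fun x => by
    simp only [vec_two]
    fun_prop
  have hper0 : ∀ x, H (x + EuclideanSpace.single 0 1) = H x := by
    obtain ⟨α, hα⟩ := hconst 0
    have h := (integral_unitCube_two (f := fun x => -V x 1) (hVc 1).neg).2
    rw [integral_neg, hmean, neg_zero] at h
    have hinner : ∀ y : ℝ, ∫ x in (0 : ℝ)..1, -V !₂[x, y] 1 = α := by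
      intro y
      rw [intervalIntegral.integral_eq_sub_of_hasDerivAt (fun x _ => hline0 y x)
        (((hVc 1).comp (hcx y)).neg.intervalIntegrable _ _), ← hα !₂[0, y]]
      congr 2
      ext i
      fin_cases i <;> simp
    simp only [hinner, intervalIntegral.integral_const, sub_zero, one_smul] at h
    exact fun x => sub_eq_zero.1 ((hα x).trans h.symm)
  have hper1 : ∀ x, H (x + EuclideanSpace.single 1 1) = H x := by
    obtain ⟨α, hα⟩ := hconst 1
    have h := (integral_unitCube_two (hVc 0)).1
    rw [hmean] at h
    have hinner : ∀ x : ℝ, ∫ y in (0 : ℝ)..1, V !₂[x, y] 0 = α := by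
      intro x
      rw [intervalIntegral.integral_eq_sub_of_hasDerivAt (fun y _ => hline1 x y)
        (((hVc 0).comp (hcy x)).intervalIntegrable _ _), ← hα !₂[x, 0]]
      congr 2
      ext i
      fin_cases i <;> simp
    simp only [hinner, intervalIntegral.integral_const, sub_zero, one_smul] at h
    exact fun x => sub_eq_zero.1 ((hα x).trans h.symm)
  intro x k
  rw [intVec_two]
  exact (((show Function.Periodic H _ from hper0).zsmul (k 0)).add_period
    ((show Function.Periodic H _ from hper1).zsmul (k 1))) x

lemma IsOrbit.stream_eq {H : Space 2 → ℝ} (hH : ∀ x, HasFDerivAt H (fluxForm V x) x)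
    {ξ : ℝ → Space 2} (hξ : IsOrbit V ξ) (s t : ℝ) : H (ξ s) = H (ξ t) := by
  have h : ∀ t, HasDerivAt (fun t => H (ξ t)) 0 t := fun t => by
    have := (hH (ξ t)).comp_hasDerivAt t (hξ.hasDerivAt t)
    rw [fluxForm_apply, mul_comm, sub_self] at this
    exact this
  exact is_const_of_deriv_eq_zero (fun t => (h t).differentiableAt) (fun t => (h t).deriv) s t

/-- Where `V` is close to a vector `w`, points are determined by the value of the stream function
and the coordinate along `w`. -/
lemma eq_of_stream_eq {H : Space 2 → ℝ} (hH : ∀ x, HasFDerivAt H (fluxForm V x) x)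
    {w : Space 2} {s : Set (Space 2)} (hs : Convex ℝ s) (hw : ∀ z ∈ s, 0 < inner ℝ w (V z))
    {a b : Space 2} (ha : a ∈ s) (hb : b ∈ s) (hab : H a = H b)
    (hin : inner ℝ w (b - a) = 0) : a = b := by
  obtain ⟨z, hz, hmv⟩ := domain_mvt (fun x _ => (hH x).hasFDerivWithinAt) hs ha hb
  have hpos := hw z (hs.segment_subset ha hb hz)
  rw [hab, sub_self, fluxForm_apply] at hmv
  simp only [PiLp.inner_apply, Fin.sum_univ_two, RCLike.inner_apply, conj_trivial] at hin hpos
  have h0 : (b - a) 0 = 0 := by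
    refine (mul_eq_zero.1 (?_ : (V z 0 * w 0 + V z 1 * w 1) * (b - a) 0 = 0)).resolve_left hpos.ne'
    linear_combination V z 0 * hin + w 1 * hmv
  have h1 : (b - a) 1 = 0 := by
    refine (mul_eq_zero.1 (?_ : (V z 0 * w 0 + V z 1 * w 1) * (b - a) 1 = 0)).resolve_left hpos.ne'
    linear_combination V z 1 * hin - w 0 * hmv
  refine (sub_eq_zero.1 ?_).symm
  ext i
  fin_cases i
  · exact h0
  · exact h1

/-- Orbits on the streamline of a regular point `y` which come close to `y` pass through `y`. -/
lemma exists_orbit_eq_of_dist_lt (hV : IsVelocityField V) {H : Space 2 → ℝ}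
    (hH : ∀ x, HasFDerivAt H (fluxForm V x) x) {y : Space 2} (hy : V y ≠ 0) :
    ∃ δ > 0, ∃ τ₀ : ℝ, ∀ η, IsOrbit V η → dist (η 0) y < δ → H (η 0) = H y →
      ∃ τ ∈ Set.Icc (-τ₀) τ₀, η τ = y := by
  obtain ⟨M, hM0, hM⟩ := hV.exists_norm_le
  set w := V y with hw
  have hwpos : 0 < ‖w‖ := norm_pos_iff.2 hy
  set κ := ‖w‖ ^ 2 / 2
  have hκ : 0 < κ := by positivity
  have hnear : ∀ᶠ z in 𝓝 y, κ < inner ℝ w (V z) := by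
    refine (continuous_const.inner hV.smooth.continuous).continuousAt.eventually_const_lt ?_
    change κ < inner ℝ w w
    rw [real_inner_self_eq_norm_sq]
    exact half_lt_self (by positivity)
  obtain ⟨r, hr, hball⟩ := Metric.eventually_nhds_iff_ball.1 hnear
  -- Within the time `τ₀` orbits move by at most `r / 2`; starting `δ`-close to `y`, they cross the
  -- line through `y` orthogonal to `w` within this time.
  set τ₀ := r / (2 * (M + 1))
  have hτ₀ : 0 < τ₀ := by positivity
  have hMτ₀ : M * τ₀ ≤ r / 2 := by
    have : (M + 1) * τ₀ = r / 2 := by simp only [τ₀]; field_simp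
    nlinarith
  refine ⟨min (r / 2) (κ * τ₀ / ‖w‖), by positivity, τ₀, fun η hη hdist hval => ?_⟩
  have hd1 : dist (η 0) y < r / 2 := hdist.trans_le (min_le_left _ _)
  have hd2 : ‖w‖ * dist (η 0) y < κ * τ₀ := by
    rw [mul_comm, ← lt_div_iff₀ hwpos]
    exact hdist.trans_le (min_le_right _ _)
  have hstay : ∀ t ∈ Set.Icc (-τ₀) τ₀, η t ∈ Metric.ball y r := by
    intro t ht
    have h1 := hη.norm_sub_le hM 0 t
    rw [sub_zero, ← dist_eq_norm] at h1
    have h2 : M * |t| ≤ M * τ₀ := mul_le_mul_of_nonneg_left (abs_le.2 ht) hM0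
    rw [Metric.mem_ball]
    linarith [dist_triangle (η t) (η 0) y]
  have hder : ∀ t, HasDerivAt (fun t => inner ℝ w (η t - y)) (inner ℝ w (V (η t))) t := fun t => by
    simpa using (hasDerivAt_const t w).inner ℝ ((hη.hasDerivAt t).sub_const y)
  have hcont : Continuous fun t => inner ℝ w (η t - y) :=
    continuous_const.inner (hη.continuous.sub continuous_const)
  have hgrow : ∀ s ∈ Set.Icc (-τ₀) τ₀, ∀ t ∈ Set.Icc (-τ₀) τ₀, s ≤ t →
      κ * (t - s) ≤ inner ℝ w (η t - y) - inner ℝ w (η s - y) := by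
    refine (convex_Icc _ _).mul_sub_le_image_sub_of_le_deriv hcont.continuousOn
      (fun t _ => (hder t).differentiableAt.differentiableWithinAt) fun t ht => ?_
    rw [(hder t).deriv]
    exact (hball _ (hstay t (interior_subset ht))).le
  have h0mem : (0 : ℝ) ∈ Set.Icc (-τ₀) τ₀ := ⟨by linarith, hτ₀.le⟩
  have hinit : |inner ℝ w (η 0 - y)| ≤ κ * τ₀ := by
    refine (abs_real_inner_le_norm _ _).trans ?_
    rw [← dist_eq_norm]
    exact hd2.le
  have hneg : -τ₀ ≤ τ₀ := by linarith
  have hup := hgrow 0 h0mem τ₀ ⟨hneg, le_rfl⟩ hτ₀.le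
  have hlo := hgrow (-τ₀) ⟨le_rfl, hneg⟩ 0 h0mem (by linarith)
  rw [abs_le] at hinit
  obtain ⟨τ, hτ, hzero⟩ := intermediate_value_Icc hneg hcont.continuousOn
    (show (0 : ℝ) ∈ _ from ⟨by linarith, by linarith⟩)
  refine ⟨τ, hτ, ?_⟩
  refine (eq_of_stream_eq hH (convex_ball y r) (fun z hz => hκ.trans (hball z hz))
    (Metric.mem_ball_self hr) (hstay τ hτ) ?_ hzero).symm
  rw [hη.stream_eq hH τ 0, hval]

end Stream

/-! ### Periodic orbits in dimension two -/

section PeriodicOrbit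

variable {n : ℕ} {V : Space n → Space n} {p : Space n}

lemma exists_isPeriodicOrbit_of_eq {ξ : ℝ → Space n} (hξ : IsOrbit V ξ) {s t : ℝ} (hst : s < t)
    {k l : Fin n → ℤ} (h : ξ s + intVec k = ξ t + intVec l) :
    IsPeriodicOrbit V (fun u => ξ (u + s)) (t - s) := by
  refine ⟨hξ.comp_add s, sub_pos.2 hst, k - l, ?_⟩
  rw [sub_add_cancel, zero_add, sub_eq_add_neg k, intVec_add, intVec_neg, ← sub_eq_add_neg,
    sub_eq_sub_iff_add_eq_add, ← h, add_comm]

/-- The asymptotic speed of a periodic orbit is its rotation over a period. -/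
lemma IsPeriodicOrbit.rotation_eq_of_tendsto (hV : IsVelocityField V) {ξ : ℝ → Space n} {s T c : ℝ}
    (hξ : IsPeriodicOrbit V (fun u => ξ (u + s)) T)
    (hc : Tendsto (fun t : ℝ => inner ℝ p (ξ t) / t) atTop (𝓝 c)) :
    inner ℝ p (ξ (T + s) - ξ (0 + s)) / T = c := by
  set b := inner ℝ p (ξ (T + s) - ξ (0 + s)) with hb
  set a := inner ℝ p (ξ (0 + s)) with ha
  have htime : Tendsto (fun j : ℕ => (j : ℝ) * T + s) atTop atTop :=
    tendsto_atTop_add_const_right _ _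
      (tendsto_natCast_atTop_atTop.atTop_mul_const hξ.period_pos)
  have h0 : ∀ x : ℝ, Tendsto (fun j : ℕ => x / (j : ℝ)) atTop (𝓝 0) := fun x =>
    tendsto_const_nhds.div_atTop tendsto_natCast_atTop_atTop
  have hlim : Tendsto (fun j : ℕ => (a / j + b) / (T + s / j)) atTop (𝓝 ((0 + b) / (T + 0))) :=
    ((h0 a).add_const b).div ((h0 s).const_add T) (by simpa using hξ.period_pos.ne')
  rw [zero_add, add_zero] at hlim
  refine tendsto_nhds_unique hlim ((hc.comp htime).congr' ?_)
  filter_upwards [eventually_gt_atTop 0] with j hj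
  have hj' : (j : ℝ) ≠ 0 := by exact_mod_cast hj.ne'
  have hit : ξ (j * T + s) = ξ (0 + s) + (j : ℝ) • (ξ (T + s) - ξ (0 + s)) :=
    hξ.apply_nat_mul hV j
  simp only [Function.comp_apply]
  rw [hit, inner_add_right, real_inner_smul_right, ← hb, ← ha, ← mul_div_mul_left _ (T + s / j) hj']
  congr 1 <;> field_simp

/-- An orbit whose speed tends to zero has asymptotic speed zero. -/
lemma IsOrbit.eq_zero_of_tendsto {ξ : ℝ → Space n} (hξ : IsOrbit V ξ) {c : ℝ}
    (hc : Tendsto (fun t : ℝ => inner ℝ p (ξ t) / t) atTop (𝓝 c))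
    (h0 : Tendsto (fun t => V (ξ t)) atTop (𝓝 0)) : c = 0 := by
  have hbound : ∀ ε > 0, |c| ≤ ‖p‖ * ε := by
    intro ε hε
    have hev := (tendsto_zero_iff_norm_tendsto_zero.1 h0).eventually_lt_const hε
    obtain ⟨t₀, ht₀⟩ := (hev.and (eventually_ge_atTop 0)).exists_forall_of_atTop
    have hlim : Tendsto (fun t : ℝ => ‖p‖ * ‖ξ t₀‖ / t + ‖p‖ * ε) atTop (𝓝 (0 + ‖p‖ * ε)) :=
      (tendsto_const_nhds.div_atTop tendsto_id).add_const _
    rw [zero_add] at hlim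
    refine le_of_tendsto_of_tendsto hc.abs hlim ?_
    filter_upwards [eventually_ge_atTop t₀, eventually_gt_atTop 0] with t ht htpos
    have ht₀0 : 0 ≤ t₀ := (ht₀ t₀ le_rfl).2
    have h1 : ‖ξ t - ξ t₀‖ ≤ ε * ‖t - t₀‖ :=
      (convex_Ici t₀).norm_image_sub_le_of_norm_hasDerivWithin_le
        (fun u _ => (hξ.hasDerivAt u).hasDerivWithinAt) (fun u hu => (ht₀ u hu).1.le)
        Set.self_mem_Ici ht
    rw [Real.norm_of_nonneg (sub_nonneg.2 ht)] at h1
    have h2 : ‖ξ t‖ ≤ ‖ξ t₀‖ + ε * t := by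
      have := norm_le_norm_add_norm_sub' (ξ t) (ξ t₀)
      nlinarith
    rw [abs_div, abs_of_pos htpos, div_le_iff₀ htpos, add_mul, div_mul_cancel₀ _ htpos.ne']
    calc |inner ℝ p (ξ t)| ≤ ‖p‖ * ‖ξ t‖ := abs_real_inner_le_norm _ _
      _ ≤ ‖p‖ * (‖ξ t₀‖ + ε * t) := mul_le_mul_of_nonneg_left h2 (norm_nonneg _)
      _ = _ := by ring
  have hle : |c| ≤ 0 := by
    have h : Tendsto (fun ε : ℝ => ‖p‖ * ε) (𝓝 0) (𝓝 (‖p‖ * 0)) := tendsto_id.const_mul _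
    rw [mul_zero] at h
    have h' : Tendsto (fun ε : ℝ => ‖p‖ * ε) (𝓝[>] 0) (𝓝 0) := h.mono_left nhdsWithin_le_nhds
    exact ge_of_tendsto h' (eventually_mem_nhdsWithin.mono hbound)
  exact abs_eq_zero.1 (le_antisymm hle (abs_nonneg c))

/-- Sequences of points of `ℝⁿ` accumulate modulo `ℤⁿ`. -/
lemma exists_tendsto_add_intVec (x : ℕ → Space n) :
    ∃ (y : Space n) (σ : ℕ → ℕ) (k : ℕ → Fin n → ℤ), StrictMono σ ∧
      Tendsto (fun j => x (σ j) + intVec (k j)) atTop (𝓝 y) := by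
  choose k hk using fun j => exists_add_intVec_mem_closedBall (x j)
  obtain ⟨y, -, σ, hσ, hy⟩ := (isCompact_closedBall (0 : Space n) (Real.sqrt n)).tendsto_subseq hk
  exact ⟨y, σ, fun j => k (σ j), hσ, hy⟩

/-- In dimension two, an orbit whose speed does not tend to zero accumulates at a regular point of
its streamline, hence passes through this point again and again modulo `ℤ²`. -/
lemma exists_isPeriodicOrbit_of_not_tendsto {V : Space 2 → Space 2} (hV : IsVelocityField V)
    {ξ : ℝ → Space 2} (hξ : IsOrbit V ξ) (h0 : ¬Tendsto (fun t => V (ξ t)) atTop (𝓝 0)) :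
    ∃ s T, IsPeriodicOrbit V (fun u => ξ (u + s)) T := by
  obtain ⟨H, hH⟩ := exists_hasFDerivAt_fluxForm hV
  have hper := isPeriodic_of_hasFDerivAt_fluxForm hV hH
  obtain ⟨ε, hε, hfreq⟩ : ∃ ε > 0, ∃ᶠ t in atTop, ε ≤ ‖V (ξ t)‖ := by
    by_contra! hcon
    refine h0 (tendsto_zero_iff_norm_tendsto_zero.2 (tendsto_order.2
      ⟨fun a ha => Eventually.of_forall fun t => ha.trans_le (norm_nonneg _), fun b hb => ?_⟩))
    simpa [not_frequently] using hcon b hb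
  obtain ⟨t, ht, htε⟩ := exists_seq_forall_of_frequently hfreq
  obtain ⟨y, σ, k, hσ, hy⟩ := exists_tendsto_add_intVec fun j => ξ (t j)
  have hVy : V y ≠ 0 := by
    have h : ε ≤ ‖V y‖ := by
      refine ge_of_tendsto ((hV.smooth.continuous.norm.tendsto y).comp hy)
        (Eventually.of_forall fun j => ?_)
      change ε ≤ ‖V (ξ (t (σ j)) + intVec (k j))‖
      rw [hV.periodic]
      exact htε (σ j)
    exact norm_pos_iff.1 (hε.trans_le h)
  have hHy : ∀ j, H (ξ (t (σ j)) + intVec (k j)) = H y := by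
    have hconst : ∀ j, H (ξ (t (σ j)) + intVec (k j)) = H (ξ 0) := fun j => by
      rw [hper, hξ.stream_eq hH _ 0]
    have hlim : Tendsto (fun j => H (ξ (t (σ j)) + intVec (k j))) atTop (𝓝 (H y)) :=
      ((hH y).continuousAt.tendsto).comp hy
    simp only [hconst] at hlim
    intro j
    rw [hconst]
    exact tendsto_nhds_unique tendsto_const_nhds hlim
  obtain ⟨δ, hδ, τ₀, hpass⟩ := exists_orbit_eq_of_dist_lt hV hH hVy
  have hclose : ∀ᶠ j in atTop, dist (ξ (t (σ j)) + intVec (k j)) y < δ :=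
    hy (Metric.ball_mem_nhds y hδ)
  have hvisit : ∀ j, dist (ξ (t (σ j)) + intVec (k j)) y < δ →
      ∃ τ ∈ Set.Icc (-τ₀) τ₀, ξ (τ + t (σ j)) + intVec (k j) = y := by
    intro j hj
    have hη := (hξ.comp_add (t (σ j))).add_intVec hV.periodic (k j)
    refine hpass _ hη ?_ ?_
    · rwa [zero_add]
    · rw [zero_add, hHy]
  obtain ⟨i, hi⟩ := hclose.exists
  obtain ⟨j, hj, hij⟩ := (hclose.and ((ht.comp hσ.tendsto_atTop).eventually_gt_atTop
    (t (σ i) + 2 * τ₀))).exists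
  obtain ⟨τ, hτ, hτy⟩ := hvisit i hi
  obtain ⟨τ', hτ', hτy'⟩ := hvisit j hj
  simp only [Function.comp_apply] at hij
  exact ⟨_, _, exists_isPeriodicOrbit_of_eq hξ (s := τ + t (σ i)) (t := τ' + t (σ j))
    (by linarith [hτ.2, hτ'.1]) (hτy.trans hτy'.symm)⟩

lemma exists_isPeriodicOrbit_rotation_eq {V : Space 2 → Space 2} (hV : IsVelocityField V)
    (p : Space 2) :
    ∃ (ξ : ℝ → Space 2) (T : ℝ), IsPeriodicOrbit V ξ T ∧
      inner ℝ p (ξ T - ξ 0) / T = growthRate V p := by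
  obtain ⟨ξ, hξ, hlim⟩ := exists_isOrbit_tendsto_growthRate hV p
  by_cases h0 : Tendsto (fun t => V (ξ t)) atTop (𝓝 0)
  · -- The orbit accumulates at a stationary point, which is a periodic orbit with zero rotation.
    obtain ⟨y, σ, k, hσ, hy⟩ := exists_tendsto_add_intVec fun j : ℕ => ξ j
    have h1 : Tendsto (fun j => V (ξ (σ j) + intVec (k j))) atTop (𝓝 (V y)) :=
      (hV.smooth.continuous.tendsto y).comp hy
    simp only [hV.periodic _ _] at h1
    have hVy : V y = 0 := tendsto_nhds_unique h1
      (h0.comp (tendsto_natCast_atTop_atTop.comp hσ.tendsto_atTop))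
    refine ⟨fun _ => y, 1, ⟨⟨contDiff_const, fun t => ?_⟩, one_pos, 0, ?_⟩, ?_⟩
    · rw [hVy]
      exact hasDerivAt_const t y
    · rw [sub_self, intVec_zero]
    · rw [sub_self, inner_zero_right, zero_div, hξ.eq_zero_of_tendsto hlim h0]
  · obtain ⟨s, T, hper⟩ := exists_isPeriodicOrbit_of_not_tendsto hV hξ h0
    exact ⟨_, T, hper, hper.rotation_eq_of_tendsto hV hlim⟩

end PeriodicOrbit

end TorusFlow

open TorusFlow
theorem theorem3p2 (n : ℕ) (V : Space n → Space n) (hV : IsVelocityField V) (p : Space n) :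
    -- (i) upper bound for all orbits, and in particular for periodic ones
    ((∀ ξ : ℝ → Space n, IsOrbit V ξ →
        limsup (fun T : ℝ => ((inner ℝ p (ξ T) / T : ℝ) : EReal)) atTop
          ≤ (growthRate V p : EReal)) ∧
      (∀ (ξ : ℝ → Space n) (T : ℝ), IsPeriodicOrbit V ξ T →
        inner ℝ p (ξ T - ξ 0) / T ≤ growthRate V p)) ∧
    -- (ii) some orbit attains the value
    (∃ ξ : ℝ → Space n, IsOrbit V ξ ∧
      Tendsto (fun T : ℝ => inner ℝ p (ξ T) / T) atTop (𝓝 (growthRate V p))) ∧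
    -- (iii) in dimension two, some periodic orbit attains the value
    (n = 2 → ∃ (ξ : ℝ → Space n) (T : ℝ), IsPeriodicOrbit V ξ T ∧
      inner ℝ p (ξ T - ξ 0) / T = growthRate V p) := by
  refine ⟨⟨fun ξ hξ => hξ.limsup_le_growthRate hV, fun ξ T hξ => hξ.rotation_le_growthRate hV⟩,
    exists_isOrbit_tendsto_growthRate hV p, ?_⟩
  rintro rfl
  exact exists_isPeriodicOrbit_rotation_eq hV p
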